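/- Let $d\ge 1$ and let $\mu_1,\dots,\mu_d$ be Borel probability measures on $\mathbb{R}^d$ for which there are exponents $p_1,\dots,p_d\in(1,+\infty)$ with $$\sum_{i=1}^d \frac1{p_i}=1\quad\text{and}\quad \sum_{i=1}^d\int_{\mathbb{R}^d}\frac{|x|^{p_i}}{p_i}\,d\mu_i(x)<+\infty$$ (in particular $d\ge 2$). Let $\Pi(\mu_1,\dots,\mu_d)$ be the set of probability measures on $(\mathbb{R}^d)^d$ with marginals $\mu_1,\dots,\mu_d$. Let $\mathcal{E}$ be the set of $d$-tuples $(\phi_1,\dots,\phi_d)$ of lower semicontinuous functions $\phi_i:\mathbb{R}^d\to\mathbb{R}\cup\{+\infty\}$ such that $\sum_{i=1}^d\phi_i(x_i)\ge\det(x_1,\dots,x_d)$ for all $(x_1,\dots,x_d)\in(\mathbb{R}^d)^d$, and let $\mathcal{E}_c$ be the set of those $(\phi_1,\dots,\phi_d)\in\mathcal{E}$ for which every $\phi_i$ is convex. The dual problem is $$(D)\qquad \inf_{(\phi_1,\dots,\phi_d)\in\mathcal{E}}\ \sum_{i=1}^d\int_{\mathbb{R}^d}\phi_i\,d\mu_i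 ,$$ where the sum is read as $+\infty$ as soon as $\int\phi_i^+\,d\mu_i=+\infty$ for some $i$; a tuple solves $(D)$ if it belongs to $\mathcal{E}$ and attains this infimum. For $y_1,\dots,y_{d-1}\in\mathbb{R}^d$ let $y_1\wedge\dots\wedge y_{d-1}\in\mathbb{R}^d$ be the vector characterized by $\langle x,\,y_1\wedge\dots\wedge y_{d-1}\rangle=\det(x,y_1,\dots,y_{d-1})$ for all $x\in\mathbb{R}^d$, and for $x_1,\dots,x_d\in\mathbb{R}^d$ let $\bigwedge_{j\ne i}x_j$ be the wedge of the vectors $x_j$, $j\neq i$, in increasing order of $j$. For $f:\mathbb{R}^d\to\mathbb{R}\cup\{+\infty\}$ let $f^*(p)=\sup_{x}(\langle x,p\rangle-f(x))$, and let $\partial f(x)$ be the set of $p\in\mathbb{R}^d$ with $f(y)\ge f(x)+\langle y-x,p\rangle$ for all $y\in\mathbb{R}^d$ if $f(x)<+\infty$, and $\partial f(x)=\emptyset$ otherwise. Let $(\varphi_1,\dots,\varphi_d)\in\mathcal{E}_c$. For $i\in\{1,\dots,d\}$ consider the conditions on $(x_1,\dots,x_d)\in(\mathbb{R}^d)^d$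 $$\text{(extr1)}\quad \sum_{j\ne i}\varphi_j(x_j)=\varphi_i^*\Big((-1)^{i+1}\bigwedge_{j\ne i}x_j\Big),\qquad \text{(extr2)}\quad (-1)^{i+1}\bigwedge_{j\ne i}x_j\in\partial\varphi_i(x_i).$$ Then the following assertions are equivalent: 1. $(\varphi_1,\dots,\varphi_d)$ solves $(D)$; 2. there exists $\gamma\in\Pi(\mu_1,\dots,\mu_d)$ such that, for every $i\in\{1,\dots,d\}$, (extr1) and (extr2) hold for $\gamma$-a.e. $(x_1,\dots,x_d)$; 3. there exist $\gamma\in\Pi(\mu_1,\dots,\mu_d)$ and $i\in\{1,\dots,d\}$ such that (extr1) and (extr2) hold for $\gamma$-a.e. $(x_1,\dots,x_d)$. -/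

import Mathlib

open MeasureTheory
open scoped ENNReal BigOperators

noncomputable section

namespace DetTransport

/-- The Euclidean space `ℝ^d`. -/
abbrev E (d : ℕ) : Type := EuclideanSpace ℝ (Fin d)

/-- `det (x_1, …, x_d)` for `d` vectors of `ℝ^d`. -/
def detVec {d : ℕ} (x : Fin d → E d) : ℝ :=
  Matrix.det (Matrix.of fun i k => x i k)

/-- The set `Π(μ_1, …, μ_d)` of probability measures on `(ℝ^d)^d` with marginals `μ_i`. -/
def couplings {d : ℕ} (μ : Fin d → Measure (E d)) : Set (Measure (Fin d → E d)) :=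
  {γ | IsProbabilityMeasure γ ∧ ∀ i, γ.map (fun x => x i) = μ i}

/-- There are exponents `p_i ∈ (1, ∞)` with `∑ 1 / p_i = 1` and
`∑ ∫ |x| ^ p_i / p_i dμ_i < ∞`. -/
def MomentCondition {d : ℕ} (μ : Fin d → Measure (E d)) : Prop :=
  ∃ p : Fin d → ℝ, (∀ i, 1 < p i) ∧ ∑ i, 1 / p i = 1 ∧
    ∑ i, ∫⁻ x, ENNReal.ofReal (‖x‖ ^ p i / p i) ∂(μ i) < ⊤

/-- The class `𝓔`: `d`-tuples of lower semicontinuous functions `ℝ^d → ℝ ∪ {+∞}`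
with `∑ φ_i(x_i) ≥ det (x_1, …, x_d)` for all `x_1, …, x_d`. -/
def admissible (d : ℕ) : Set (Fin d → E d → EReal) :=
  {φ | (∀ i x, φ i x ≠ ⊥) ∧ (∀ i, LowerSemicontinuous (φ i)) ∧
    ∀ x : Fin d → E d, (detVec x : EReal) ≤ ∑ i, φ i (x i)}

/-- Convexity of a function with values in `ℝ ∪ {+∞}`. -/
def IsConvexFun {d : ℕ} (f : E d → EReal) : Prop :=
  ∀ x y : E d, ∀ a b : ℝ, 0 < a → 0 < b → a + b = 1 →
    f (a • x + b • y) ≤ (a : EReal) * f x + (b : EReal) * f y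

/-- The class `𝓔_c` of elements of `𝓔` all of whose components are convex. -/
def convexAdmissible (d : ℕ) : Set (Fin d → E d → EReal) :=
  {φ | φ ∈ admissible d ∧ ∀ i, IsConvexFun (φ i)}

/-- `∑ ∫ φ_i^+ dμ_i`. -/
def posPart {d : ℕ} (μ : Fin d → Measure (E d)) (φ : Fin d → E d → EReal) : ℝ≥0∞ :=
  ∑ i, ∫⁻ x, (φ i x).toENNReal ∂(μ i)

/-- `∑ ∫ φ_i^- dμ_i`. -/
def negPart {d : ℕ} (μ : Fin d → Measure (E d)) (φ : Fin d → E d → EReal) : ℝ≥0∞ :=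
  ∑ i, ∫⁻ x, (-φ i x).toENNReal ∂(μ i)

open Classical in
/-- The dual objective `∑ ∫ φ_i dμ_i`, with values in `[-∞, +∞]`, and with the convention
`(+∞) + (-∞) = +∞` of minimization problems (in `EReal` itself, `⊤ + ⊥ = ⊥`). -/
def dualValue {d : ℕ} (μ : Fin d → Measure (E d)) (φ : Fin d → E d → EReal) : EReal :=
  if posPart μ φ = ⊤ then ⊤ else (posPart μ φ : EReal) - (negPart μ φ : EReal)

/-- `φ` is a solution of the dual problem: it minimizes `∑ ∫ φ_i dμ_i` over `𝓔`. -/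
def SolvesDual {d : ℕ} (μ : Fin d → Measure (E d)) (φ : Fin d → E d → EReal) : Prop :=
  φ ∈ admissible d ∧ ∀ ψ ∈ admissible d, dualValue μ φ ≤ dualValue μ ψ

/-- The vector `y_1 ∧ … ∧ y_{d-1}` of `ℝ^d`, here `d = n + 1`; its `k`-th coordinate is
`det (e_k, y_1, …, y_{d-1})`. -/
def wedge {n : ℕ} (y : Fin n → E (n + 1)) : E (n + 1) :=
  WithLp.toLp 2 fun k =>
    detVec (Fin.cons (EuclideanSpace.single k (1 : ℝ)) y : Fin (n + 1) → E (n + 1))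

/-- The identity that characterizes the wedge product:
`⟨x, y_1 ∧ … ∧ y_{d-1}⟩ = det (x, y_1, …, y_{d-1})`. -/
theorem inner_wedge {n : ℕ} (x : E (n + 1)) (y : Fin n → E (n + 1)) :
    inner ℝ x (wedge y) = detVec (Fin.cons x y : Fin (n + 1) → E (n + 1)) := by
  have h : ∀ z : E (n + 1), detVec (Fin.cons z y : Fin (n + 1) → E (n + 1)) =
      ∑ k : Fin (n + 1), z k * ((-1) ^ (k : ℕ) *
        Matrix.det (Matrix.of fun (i j : Fin n) => y i (k.succAbove j))) := by
    intro z
    rw [detVec, Matrix.det_succ_row_zero]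
    refine Finset.sum_congr rfl fun k _ => ?_
    have : (Matrix.of fun i k => (Fin.cons z y : Fin (n + 1) → E (n + 1)) i k).submatrix
        Fin.succ k.succAbove = Matrix.of fun (i j : Fin n) => y i (k.succAbove j) := by
      ext i j
      simp
    rw [this]
    simp only [Matrix.of_apply, Fin.cons_zero]
    ring
  rw [h x, PiLp.inner_apply]
  refine Finset.sum_congr rfl fun k _ => ?_
  have hk : (wedge y) k = (-1) ^ (k : ℕ) *
      Matrix.det (Matrix.of fun (i j : Fin n) => y i (k.succAbove j)) := by
    change detVec _ = _
    rw [h, Finset.sum_eq_single k]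
    · simp
    · intro b _ hb
      simp [hb]
    · simp
  rw [hk]
  simp [mul_comm]

/-- The vector `(-1)^{i+1} ⋀_{j ≠ i} x_j`. The index `i : Fin (n + 1)` starts at `0`, so the
sign is `(-1)^i` here. -/
def signedWedge {n : ℕ} (i : Fin (n + 1)) (x : Fin (n + 1) → E (n + 1)) : E (n + 1) :=
  (-1 : ℝ) ^ (i : ℕ) • wedge fun j : Fin n => x (i.succAbove j)

/-- The Legendre–Fenchel conjugate `f^*(p) = sup_x (⟨x, p⟩ - f x)`. -/
def conjugate {d : ℕ} (f : E d → EReal) (p : E d) : EReal :=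
  ⨆ x : E d, ((inner ℝ x p : ℝ) : EReal) - f x

/-- The subdifferential `∂f(x)`, empty where `f` is not finite. -/
def subdifferential {d : ℕ} (f : E d → EReal) (x : E d) : Set (E d) :=
  {p | f x ≠ ⊤ ∧ f x ≠ ⊥ ∧ ∀ y : E d, f x + ((inner ℝ (y - x) p : ℝ) : EReal) ≤ f y}

/-- The two extremality conditions with index `i` at the point `x = (x_1, …, x_d)`:
`∑_{j ≠ i} φ_j(x_j) = φ_i^*((-1)^{i+1} ⋀_{j ≠ i} x_j)` and
`(-1)^{i+1} ⋀_{j ≠ i} x_j ∈ ∂φ_i(x_i)`. -/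
def Extremal {n : ℕ} (φ : Fin (n + 1) → E (n + 1) → EReal) (i : Fin (n + 1))
    (x : Fin (n + 1) → E (n + 1)) : Prop :=
  ∑ j ∈ Finset.univ.erase i, φ j (x j) = conjugate (φ i) (signedWedge i x) ∧
    signedWedge i x ∈ subdifferential (φ i) (x i)

end DetTransport

end

/-! At a single point, (extr1) and (extr2) for one index `i` amount to saying that all `φ j (x j)`
are finite and `∑ j, φ j (x j) = detVec x`: the subgradient condition is Fenchel equality for `φ i`,
and `⟨x i, signedWedge i x⟩ = detVec x`. This condition does not involve `i`, so assertions 2 and 3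
both say that some coupling is carried by the contact set of the constraint
(`Extremal.exists_sum_eq_detVec`, `extremal_of_sum_eq_detVec`).

If such a coupling `γ` exists, the dual value of `φ` equals `∫ detVec ∂γ`, which by weak duality
bounds every other dual value from below; hence `φ` solves (D).

Conversely, let `φ` solve (D) with value `D`. Strong duality with attainment
(`exists_coupling_le_integral`) gives a coupling `γ` with `D ≤ ∫ detVec ∂γ`. The nonnegative gap `∑
φ i (x i) - detVec x` then has `γ`-integral zero, so it vanishes almost everywhere. The coupling
comes from the M. Riesz extension theorem followed by Riesz–Markov–Kakutani; coercivity of the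
integrable moment functions prevents loss of mass at infinity. -/

open Filter Topology
open scoped CompactlySupported NNReal

/-! ### Kantorovich duality: existence of a coupling from a dual bound -/

section Duality

variable {ι F : Type*} [Fintype ι]

/-- The space of continuous `ν`-integrable real functions. -/
def continuousIntegrable [TopologicalSpace F] [MeasurableSpace F] (ν : Measure F) :
    Submodule ℝ (F → ℝ) where
  carrier := {f | Continuous f ∧ Integrable f ν}
  add_mem' := fun ha hb => ⟨ha.1.add hb.1, ha.2.add hb.2⟩
  zero_mem' := ⟨continuous_zero, integrable_zero _ _ _⟩
  smul_mem' := fun c _ ha => ⟨ha.1.const_smul c, ha.2.smul c⟩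

/-- The cone of triples `(ψ, t, f)` with `f + t c ≤ ∑ ψ_i`. -/
def dominationCone [TopologicalSpace F] [MeasurableSpace F] (ν : ι → Measure F)
    (c : (ι → F) → ℝ) :
    PointedCone ℝ ((∀ i, continuousIntegrable (ν i)) × ℝ × C_c(ι → F, ℝ)) where
  carrier := {z | ∀ x, z.2.2 x + z.2.1 * c x ≤ ∑ i, (z.1 i : F → ℝ) (x i)}
  add_mem' := by
    intro a b ha hb x
    have h1 := ha x
    have h2 := hb x
    simp only [Prod.fst_add, Prod.snd_add, Pi.add_apply, Submodule.coe_add,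
      CompactlySupportedContinuousMap.coe_add, Finset.sum_add_distrib] at h1 h2 ⊢
    linarith
  zero_mem' := by intro x; simp
  smul_mem' := by
    rintro ⟨r, hr⟩ a ha x
    have h1 := mul_le_mul_of_nonneg_left (ha x) hr
    change r * a.2.2 x + r * a.2.1 * c x ≤ ∑ i, r * (a.1 i : F → ℝ) (x i)
    rw [← Finset.mul_sum]
    linarith

/-- A functional on `C_c` dominated by the separable functions above it, with the value of the
cost `c` prescribed to be `D`. -/
theorem exists_dominated_functional [Nonempty ι] [TopologicalSpace F] [MeasurableSpace F]
    (ν : ι → Measure F) [∀ i, IsProbabilityMeasure (ν i)] (c : (ι → F) → ℝ) (D : ℝ)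
    (hD : ∀ ψ : ι → F → ℝ, (∀ i, Continuous (ψ i)) → (∀ i, Integrable (ψ i) (ν i)) →
      ∀ t : ℝ, (∀ x : ι → F, t * c x ≤ ∑ i, ψ i (x i)) → t * D ≤ ∑ i, ∫ y, ψ i y ∂(ν i)) :
    ∃ L : C_c(ι → F, ℝ) →ₗ[ℝ] ℝ, ∀ (f : C_c(ι → F, ℝ)) (ψ : ι → F → ℝ) (t : ℝ),
      (∀ i, Continuous (ψ i)) → (∀ i, Integrable (ψ i) (ν i)) →
      (∀ x, f x + t * c x ≤ ∑ i, ψ i (x i)) → L f + t * D ≤ ∑ i, ∫ y, ψ i y ∂(ν i) := by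
  classical
  let W := ∀ i, continuousIntegrable (ν i)
  let Φ : (W × ℝ × C_c(ι → F, ℝ)) →ₗ[ℝ] ℝ :=
    { toFun := fun z => ∑ i, ∫ y, (z.1 i : F → ℝ) y ∂(ν i) - z.2.1 * D
      map_add' := by
        intro a b
        have h : ∀ i, ∫ y, ((a + b).1 i : F → ℝ) y ∂(ν i) =
            ∫ y, (a.1 i : F → ℝ) y ∂(ν i) + ∫ y, (b.1 i : F → ℝ) y ∂(ν i) := fun i =>
          integral_add (a.1 i).2.2 (b.1 i).2.2
        rw [Finset.sum_congr rfl fun i _ => h i, Finset.sum_add_distrib, Prod.snd_add,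
          Prod.fst_add]
        ring
      map_smul' := by
        intro r a
        have h : ∀ i, ∫ y, ((r • a).1 i : F → ℝ) y ∂(ν i) =
            r * ∫ y, (a.1 i : F → ℝ) y ∂(ν i) := fun i =>
          integral_const_mul r _
        rw [Finset.sum_congr rfl fun i _ => h i, ← Finset.mul_sum, Prod.smul_snd, Prod.smul_fst,
          smul_eq_mul, smul_eq_mul, RingHom.id_apply]
        ring }
  -- `Φ` ignores `f`, so only its restriction to `f = 0` matters; there `hD` is exactly its
  -- positivity on the cone. The real coordinate `t` stands for multiples of `c`, which need not
  -- have compact support.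
  let S : Submodule ℝ (W × ℝ × C_c(ι → F, ℝ)) :=
    LinearMap.ker ((LinearMap.snd ℝ ℝ C_c(ι → F, ℝ)).comp (LinearMap.snd ℝ W _))
  obtain ⟨g, hg, hpos⟩ := riesz_extension (dominationCone ν c) ⟨S, Φ.comp S.subtype⟩
    (by
      rintro ⟨⟨ψ, t, f⟩, hz⟩ hs
      have hf : f = 0 := hz
      subst hf
      have := hD (fun i => ψ i) (fun i => (ψ i).2.1) (fun i => (ψ i).2.2) t
        (fun x => by simpa using hs x)
      change 0 ≤ ∑ i, ∫ y, (ψ i : F → ℝ) y ∂(ν i) - t * D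
      linarith)
    (by
      rintro ⟨ψ, t, f⟩
      -- Cofinality: `f` is bounded above by some `M`, so adding `(χ - ψ, -t, 0)`, where the
      -- components of `χ` sum to `M`, moves any triple into the cone.
      obtain ⟨M, hM⟩ : ∃ M, ∀ x, f x ≤ M := by
        obtain ⟨M, hM⟩ := (f.continuous.bounded_above_of_compact_support f.hasCompactSupport)
        exact ⟨M, fun x => (le_abs_self _).trans (hM x)⟩
      let i₀ : ι := Classical.arbitrary ι
      let χ : W := Pi.single i₀ ⟨fun _ => M, continuous_const, integrable_const M⟩
      refine ⟨⟨(χ - ψ, -t, 0), rfl⟩, fun x => ?_⟩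
      have h : ∑ i, ((χ i : F → ℝ) (x i)) = M := by
        rw [Finset.sum_eq_single i₀]
        · simp [χ]
        · intro j _ hj
          simp [χ, hj]
        · simp
      change (0 + f) x + (-t + t) * c x ≤ ∑ i, (((χ i : F → ℝ) (x i) - (ψ i : F → ℝ) (x i)) +
        (ψ i : F → ℝ) (x i))
      simp [h, hM x])
  -- Positivity of `g` reads `∑ ∫ ψ i - t * D + g (0, 0, f) ≥ 0`, hence the sign.
  refine ⟨-(g.comp ((LinearMap.inr ℝ W _).comp (LinearMap.inr ℝ ℝ _))), ?_⟩
  intro f ψ t hc hi h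
  let w : W := fun i => ⟨ψ i, hc i, hi i⟩
  have h1 := hpos (w, t, f) h
  have h2 : g (w, t, 0) = ∑ i, ∫ y, ψ i y ∂(ν i) - t * D := hg ⟨(w, t, 0), rfl⟩
  have h3 : ((w, t, f) : W × ℝ × C_c(ι → F, ℝ)) = (w, t, 0) + (0, 0, f) := by simp
  rw [h3, map_add, h2] at h1
  change -(g (0, 0, f)) + t * D ≤ _
  linarith

variable {X : Type*} [TopologicalSpace X] [R1Space X]

/-- A nonnegative continuous function times a cutoff built from a coercive function. -/
noncomputable def cutoffMul (H G : X → ℝ) (hH : Continuous H) (hG : Continuous G)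
    (hK : ∀ M, IsCompact {x | H x ≤ M}) (k : ℕ) : C_c(X, ℝ) where
  toFun x := G x * max 0 (1 - H x / (k + 1))
  continuous_toFun := by fun_prop
  hasCompactSupport' := by
    refine HasCompactSupport.of_support_subset_isCompact (hK (k + 1)) fun x hx => ?_
    by_contra h
    refine hx ?_
    have hk : (0 : ℝ) < k + 1 := by positivity
    have : 1 ≤ H x / (k + 1) := by
      rw [le_div_iff₀ hk]
      simp only [Set.mem_ofPred_eq, not_le] at h
      linarith
    simp [max_eq_left (sub_nonpos.2 this)]

/-- The cutoffs increase to `G` as `k → ∞`, so monotone convergence carries bounds from compactly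
supported functions to `G`. -/
theorem lintegral_le_of_cutoffMul_le [MeasurableSpace X] [BorelSpace X] {γ : Measure X}
    {H G : X → ℝ} (hH : Continuous H) (hG : Continuous G)
    (hK : ∀ M, IsCompact {x | H x ≤ M}) (hH0 : ∀ x, 0 ≤ H x) (hG0 : ∀ x, 0 ≤ G x) {B : ℝ≥0∞}
    (h : ∀ k, ∫⁻ x, ENNReal.ofReal (cutoffMul H G hH hG hK k x) ∂γ ≤ B) :
    ∫⁻ x, ENNReal.ofReal (G x) ∂γ ≤ B := by
  refine le_of_tendsto' (lintegral_tendsto_of_tendsto_of_monotone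
    (f := fun k x => ENNReal.ofReal (cutoffMul H G hH hG hK k x))
    (fun k => ?_) (ae_of_all _ fun x => ?_) (ae_of_all _ fun x => ?_)) h
  · exact (ENNReal.measurable_ofReal.comp
      (cutoffMul H G hH hG hK k).continuous.measurable).aemeasurable
  · intro k l hkl
    refine ENNReal.ofReal_le_ofReal (mul_le_mul_of_nonneg_left (max_le_max le_rfl ?_) (hG0 x))
    have : (k : ℝ) ≤ l := by exact_mod_cast hkl
    have := div_le_div_of_nonneg_left (hH0 x) (by positivity : (0 : ℝ) < k + 1)
      (by linarith : (k + 1 : ℝ) ≤ l + 1)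
    linarith
  · refine ENNReal.tendsto_ofReal ?_
    have h1 : Tendsto (fun k : ℕ => H x / ((k : ℝ) + 1)) atTop (𝓝 0) :=
      tendsto_const_nhds.div_atTop
        (tendsto_atTop_add_const_right _ _ tendsto_natCast_atTop_atTop)
    have h2 : Tendsto (fun k : ℕ => G x * max 0 (1 - H x / ((k : ℝ) + 1))) atTop
        (𝓝 (G x * max 0 (1 - 0))) :=
      ((tendsto_const_nhds.max (tendsto_const_nhds.sub h1))).const_mul _
    simpa using! h2

theorem cutoffMul_le {H G : X → ℝ} (hH : Continuous H) (hG : Continuous G)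
    (hK : ∀ M, IsCompact {x | H x ≤ M}) (hH0 : ∀ x, 0 ≤ H x) (hG0 : ∀ x, 0 ≤ G x) (k : ℕ)
    (x : X) : cutoffMul H G hH hG hK k x ≤ G x := by
  refine mul_le_of_le_one_right (hG0 x) (max_le zero_le_one ?_)
  have : 0 ≤ H x / ((k : ℝ) + 1) := div_nonneg (hH0 x) (by positivity)
  linarith

theorem cutoffMul_nonneg {H G : X → ℝ} (hH : Continuous H) (hG : Continuous G)
    (hK : ∀ M, IsCompact {x | H x ≤ M}) (hG0 : ∀ x, 0 ≤ G x) (k : ℕ)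
    (x : X) : 0 ≤ cutoffMul H G hH hG hK k x :=
  mul_nonneg (hG0 x) (le_max_left _ _)

/-- This is the tightness estimate: the cutoff loses at most a multiple of `H` that tends to zero,
and `H` will be separable and integrable. -/
theorem le_cutoffMul {H G : X → ℝ} (hH : Continuous H) (hG : Continuous G)
    (hK : ∀ M, IsCompact {x | H x ≤ M}) (hH0 : ∀ x, 0 ≤ H x) (hG0 : ∀ x, 0 ≤ G x) {M : ℝ}
    (hM : ∀ x, G x ≤ M) (k : ℕ) (x : X) :
    G x - M / (k + 1) * H x ≤ cutoffMul H G hH hG hK k x := by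
  have h0 : 0 ≤ H x / ((k : ℝ) + 1) := div_nonneg (hH0 x) (by positivity)
  have h1 : G x * (1 - H x / (k + 1)) ≤ cutoffMul H G hH hG hK k x :=
    mul_le_mul_of_nonneg_left (le_max_right _ _) (hG0 x)
  have h2 := mul_le_mul_of_nonneg_right (hM x) h0
  have h3 : M / (k + 1) * H x = M * (H x / (k + 1)) := by ring
  linarith

/-- Attainment in the multi-marginal Kantorovich problem: if `D` is at most the value of the dual
problem, then some coupling has cost at least `D`. -/
theorem exists_coupling_le_integral [Nonempty ι] [MetricSpace F] [LocallyCompactSpace F]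
    [SecondCountableTopology F] [MeasurableSpace F] [BorelSpace F]
    (ν : ι → Measure F) [∀ i, IsProbabilityMeasure (ν i)] (c : (ι → F) → ℝ) (hc : Continuous c)
    (h : ι → F → ℝ) (hcont : ∀ i, Continuous (h i)) (hint : ∀ i, Integrable (h i) (ν i))
    (h0 : ∀ i y, 0 ≤ h i y) (hle : ∀ x, |c x| ≤ ∑ i, h i (x i))
    (hK : ∀ M, IsCompact {x : ι → F | ∑ i, h i (x i) ≤ M}) (D : ℝ)
    (hD : ∀ ψ : ι → F → ℝ, (∀ i, Continuous (ψ i)) → (∀ i, Integrable (ψ i) (ν i)) →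
      ∀ t : ℝ, (∀ x : ι → F, t * c x ≤ ∑ i, ψ i (x i)) → t * D ≤ ∑ i, ∫ y, ψ i y ∂(ν i)) :
    ∃ γ : Measure (ι → F), IsProbabilityMeasure γ ∧ (∀ i, γ.map (fun x => x i) = ν i) ∧
      D ≤ ∫ x, c x ∂γ := by
  classical
  obtain ⟨L, hL⟩ := exists_dominated_functional ν c D hD
  have hLpos : ∀ f : C_c(ι → F, ℝ), 0 ≤ f → 0 ≤ L f := by
    intro f hf
    have := hL (-f) (fun _ _ => 0) 0 (fun _ => continuous_const)
      (fun _ => integrable_const 0) (fun x => by simpa using hf x)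
    simpa using this
  let Λ : C_c(ι → F, ℝ) →ₚ[ℝ] ℝ := PositiveLinearMap.mk₀ L hLpos
  let γ := RealRMK.rieszMeasure Λ
  have hγ : ∀ f : C_c(ι → F, ℝ), (∀ x, 0 ≤ f x) →
      ∫⁻ x, ENNReal.ofReal (f x) ∂γ = ENNReal.ofReal (L f) := by
    intro f hf
    have hfi : Integrable (fun x => f x) γ :=
      f.continuous.integrable_of_hasCompactSupport f.hasCompactSupport
    rw [← ofReal_integral_eq_lintegral_ofReal hfi (ae_of_all _ hf)]
    exact congrArg _ (RealRMK.integral_rieszMeasure Λ f)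
  let H : (ι → F) → ℝ := fun x => ∑ i, h i (x i)
  have hH : Continuous H := by fun_prop
  have hH0 : ∀ x, 0 ≤ H x := fun x => Finset.sum_nonneg fun i _ => h0 i _
  -- The marginals, tested on bounded `g ≥ 0`. The upper bound dominates the cutoff of `g (x i)` by
  -- `g` itself; the lower bound dominates its negative by `M / (k + 1) * H - g (x i)`.
  have key : ∀ (i : ι) (g : F → ℝ), Continuous g → (∀ y, 0 ≤ g y) → ∀ M, (∀ y, g y ≤ M) →
      ∫⁻ x, ENNReal.ofReal (g (x i)) ∂γ = ENNReal.ofReal (∫ y, g y ∂(ν i)) := by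
    intro i g hg hg0 M hM
    have hgi : Integrable g (ν i) := Integrable.of_bound hg.aestronglyMeasurable M
      (ae_of_all _ fun y => by rw [Real.norm_eq_abs, abs_of_nonneg (hg0 y)]; exact hM y)
    have hG : Continuous fun x : ι → F => g (x i) := by fun_prop
    have hsing : ∀ x : ι → F, ∑ j, (Pi.single i g : ι → F → ℝ) j (x j) = g (x i) := by
      intro x
      rw [Finset.sum_eq_single i (fun j _ hj => by simp [hj]) (by simp)]
      simp
    have hsingint : ∑ j, ∫ y, (Pi.single i g : ι → F → ℝ) j y ∂(ν j) = ∫ y, g y ∂(ν i) := by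
      rw [Finset.sum_eq_single i (fun j _ hj => by simp [hj]) (by simp)]
      simp
    have hsc : ∀ j, Continuous ((Pi.single i g : ι → F → ℝ) j) := by
      intro j
      rcases eq_or_ne j i with rfl | hj
      · simpa using hg
      · simpa [hj] using continuous_zero
    have hsi : ∀ j, Integrable ((Pi.single i g : ι → F → ℝ) j) (ν j) := by
      intro j
      rcases eq_or_ne j i with rfl | hj
      · simpa using hgi
      · simp [hj]
    apply le_antisymm
    · refine lintegral_le_of_cutoffMul_le hH hG hK hH0 (fun x => hg0 _) fun k => ?_
      rw [hγ _ (cutoffMul_nonneg hH hG hK (fun x => hg0 _) k)]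
      refine ENNReal.ofReal_le_ofReal ?_
      have := hL (cutoffMul H _ hH hG hK k) (Pi.single i g) 0 hsc hsi (fun x => by
        rw [hsing]
        simpa using cutoffMul_le hH hG hK hH0 (fun x => hg0 _) k x)
      simpa [hsingint] using this
    · have hlow : ∀ k : ℕ, ENNReal.ofReal (∫ y, g y ∂(ν i) -
          M / (k + 1) * ∑ j, ∫ y, h j y ∂(ν j)) ≤ ∫⁻ x, ENNReal.ofReal (g (x i)) ∂γ := by
        intro k
        have h1 := hL (-cutoffMul H _ hH hG hK k)
          (fun j y => M / (k + 1) * h j y - (Pi.single i g : ι → F → ℝ) j y) 0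
          (fun j => ((hcont j).const_mul _).sub (hsc j))
          (fun j => ((hint j).const_mul _).sub (hsi j)) (fun x => by
            rw [Finset.sum_sub_distrib, hsing, ← Finset.mul_sum]
            have := le_cutoffMul hH hG hK hH0 (fun x => hg0 _) (fun x => hM _) k x
            simp only [CompactlySupportedContinuousMap.coe_neg, Pi.neg_apply]
            linarith)
        have h2 : ∀ j, ∫ y, (M / (k + 1) * h j y - (Pi.single i g : ι → F → ℝ) j y) ∂(ν j) =
            M / (k + 1) * ∫ y, h j y ∂(ν j) - ∫ y, (Pi.single i g : ι → F → ℝ) j y ∂(ν j) := by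
          intro j
          rw [integral_sub ((hint j).const_mul _) (hsi j), integral_const_mul]
        simp only [h2, Finset.sum_sub_distrib, hsingint, ← Finset.mul_sum, map_neg] at h1
        calc _ ≤ ENNReal.ofReal (L (cutoffMul H _ hH hG hK k)) :=
              ENNReal.ofReal_le_ofReal (by linarith)
          _ = ∫⁻ x, ENNReal.ofReal (cutoffMul H _ hH hG hK k x) ∂γ :=
              (hγ _ (cutoffMul_nonneg hH hG hK (fun x => hg0 _) k)).symm
          _ ≤ _ := lintegral_mono fun x => ENNReal.ofReal_le_ofReal
              (cutoffMul_le hH hG hK hH0 (fun x => hg0 _) k x)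
      have h1 : Tendsto (fun k : ℕ => M / ((k : ℝ) + 1)) atTop (𝓝 0) :=
        tendsto_const_nhds.div_atTop
          (tendsto_atTop_add_const_right _ _ tendsto_natCast_atTop_atTop)
      have h2 := (h1.mul_const (∑ j, ∫ y, h j y ∂(ν j))).const_sub (∫ y, g y ∂(ν i))
      rw [zero_mul, sub_zero] at h2
      exact le_of_tendsto' (ENNReal.tendsto_ofReal h2) hlow
  have hprob : IsProbabilityMeasure γ := by
    constructor
    have := key (Classical.arbitrary ι) (fun _ => 1) continuous_const (fun _ => zero_le_one) 1
      (fun _ => le_rfl)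
    simpa using this
  have hmarg : ∀ i, γ.map (fun x => x i) = ν i := by
    intro i
    refine (ext_of_forall_lintegral_eq_of_IsFiniteMeasure fun f => ?_).symm
    have hf : Continuous fun y => ((f y : ℝ≥0) : ℝ) := by fun_prop
    obtain ⟨M, hM⟩ : ∃ M : ℝ, ∀ y, ((f y : ℝ≥0) : ℝ) ≤ M := by
      refine ⟨nndist f 0, fun y => ?_⟩
      simpa [NNReal.dist_eq] using BoundedContinuousFunction.dist_coe_le_dist (f := f) (g := 0) y
    have hk := key i (fun y => (f y : ℝ)) hf (fun y => (f y).2) M hM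
    have hfi : Integrable (fun y => ((f y : ℝ≥0) : ℝ)) (ν i) :=
      Integrable.of_bound hf.aestronglyMeasurable M
        (ae_of_all _ fun y => by simpa using hM y)
    rw [ofReal_integral_eq_lintegral_ofReal hfi (ae_of_all _ fun y => (f y).2)] at hk
    simp only [ENNReal.ofReal_coe_nnreal] at hk
    rw [lintegral_map (by fun_prop) (measurable_pi_apply i)]
    exact hk.symm
  refine ⟨γ, hprob, hmarg, ?_⟩
  have hmp : ∀ i, MeasurePreserving (fun x : ι → F => x i) γ (ν i) := fun i =>
    ⟨measurable_pi_apply i, hmarg i⟩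
  have hHint : Integrable H γ := integrable_finsetSum _ fun i _ =>
    (hmp i).integrable_comp_of_integrable (hint i)
  have hHval : ∫ x, H x ∂γ = ∑ i, ∫ y, h i y ∂(ν i) := by
    refine (integral_finsetSum _ fun i _ =>
      (hmp i).integrable_comp_of_integrable (hint i)).trans ?_
    refine Finset.sum_congr rfl fun i _ => ?_
    simp only [Function.comp_apply]
    rw [← hmarg i, integral_map (measurable_pi_apply i).aemeasurable
      (hcont i).aestronglyMeasurable]
  have hcint : Integrable c γ := hHint.mono' hc.aestronglyMeasurable
    (ae_of_all _ fun x => by simpa using hle x)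
  have hG : Continuous fun x => H x - c x := hH.sub hc
  have hG0 : ∀ x, 0 ≤ H x - c x := fun x => sub_nonneg.2 ((le_abs_self _).trans (hle x))
  -- With `t = 1` and `ψ = h`, domination of the cutoffs of `H - c` yields `∫ (H - c) ∂γ ≤ ∑ ∫ h i -
  -- D`; since `∫ H ∂γ = ∑ ∫ h i`, this is the claim. The case `f = 0` makes the right side
  -- nonnegative, as `ENNReal.ofReal` requires.
  have hDle := hL 0 h 1 hcont hint (fun x => by simpa using (le_abs_self _).trans (hle x))
  have hfin : ∫⁻ x, ENNReal.ofReal (H x - c x) ∂γ ≤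
      ENNReal.ofReal (∑ i, ∫ y, h i y ∂(ν i) - D) := by
    refine lintegral_le_of_cutoffMul_le hH hG hK hH0 hG0 fun k => ?_
    rw [hγ _ (cutoffMul_nonneg hH hG hK hG0 k)]
    refine ENNReal.ofReal_le_ofReal ?_
    have := hL (cutoffMul H _ hH hG hK k) h 1 hcont hint (fun x => by
      have := cutoffMul_le hH hG hK hH0 hG0 k x
      simp only [H] at this ⊢
      linarith)
    linarith
  have hGint : Integrable (fun x => H x - c x) γ := hHint.sub hcint
  rw [← ofReal_integral_eq_lintegral_ofReal hGint (ae_of_all _ hG0),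
    ENNReal.ofReal_le_ofReal_iff (by simp at hDle; linarith),
    integral_sub hHint hcint, hHval] at hfin
  linarith

end Duality

/-! ### Finite sums of extended reals -/

namespace DetTransport

theorem ereal_coe_sum {ι : Type*} (s : Finset ι) (f : ι → ℝ) :
    ((∑ i ∈ s, f i : ℝ) : EReal) = ∑ i ∈ s, (f i : EReal) :=
  map_sum (⟨⟨Real.toEReal, EReal.coe_zero⟩, EReal.coe_add⟩ : ℝ →+ EReal) f s

theorem ereal_sum_ne_bot {ι : Type*} {s : Finset ι} {f : ι → EReal} (h : ∀ i ∈ s, f i ≠ ⊥) :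
    ∑ i ∈ s, f i ≠ ⊥ := by
  classical
  induction s using Finset.induction_on with
  | empty => simp
  | insert a s ha ih =>
    rw [Finset.sum_insert ha]
    exact EReal.add_ne_bot_iff.2 ⟨h a (Finset.mem_insert_self _ _),
      ih fun i hi => h i (Finset.mem_insert_of_mem hi)⟩

theorem ereal_ne_top_of_sum_ne_top {ι : Type*} {s : Finset ι} {f : ι → EReal}
    (h : ∀ i ∈ s, f i ≠ ⊥) (hs : ∑ i ∈ s, f i ≠ ⊤) {i : ι} (hi : i ∈ s) : f i ≠ ⊤ := by
  classical
  intro hf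
  rw [← Finset.add_sum_erase s f hi, hf] at hs
  exact hs (EReal.top_add_of_ne_bot
    (ereal_sum_ne_bot fun j hj => h j (Finset.mem_of_mem_erase hj)))

/-! ### The determinant and the signed wedge product -/

section Determinant

variable {d n : ℕ}

theorem continuous_detVec : Continuous (detVec : (Fin d → E d) → ℝ) := by
  unfold detVec
  refine Continuous.matrix_det (continuous_pi fun i => continuous_pi fun k => ?_)
  simp only [Matrix.of_apply]
  fun_prop

theorem abs_detVec_le (x : Fin d → E d) : |detVec x| ≤ d.factorial * ∏ i, ‖x i‖ := by
  rw [detVec, ← Matrix.det_transpose, Matrix.det_apply']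
  refine (Finset.abs_sum_le_sum_abs _ _).trans ?_
  have h : ∀ σ : Equiv.Perm (Fin d), |((Equiv.Perm.sign σ : ℤ) : ℝ) *
      ∏ i, (Matrix.of fun i k => x i k).transpose (σ i) i| ≤ ∏ i, ‖x i‖ := by
    intro σ
    rw [abs_mul, Finset.abs_prod]
    have hs : |((Equiv.Perm.sign σ : ℤ) : ℝ)| = 1 := by
      rcases Int.units_eq_one_or (Equiv.Perm.sign σ) with h | h <;> simp [h]
    rw [hs, one_mul]
    exact Finset.prod_le_prod (fun _ _ => abs_nonneg _) fun i _ => PiLp.norm_apply_le (x i) (σ i)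
  refine (Finset.sum_le_sum fun σ _ => h σ).trans_eq ?_
  simp [Fintype.card_perm]

/-- Moving row `i` to the front is a cycle of sign `(-1)^i`, which cancels the sign in
`signedWedge`. -/
theorem inner_signedWedge (i : Fin (n + 1)) (x : Fin (n + 1) → E (n + 1)) (y : E (n + 1)) :
    inner ℝ y (signedWedge i x) = detVec (Function.update x i y) := by
  rw [signedWedge, inner_smul_right, inner_wedge]
  have h := Fin.cons_removeNth_eq_comp_cycleRange_symm (Function.update x i y) i
  rw [Function.update_self, Fin.removeNth_update] at h
  change (-1 : ℝ) ^ (i : ℕ) * detVec (Fin.cons y (i.removeNth x) : Fin (n + 1) → E (n + 1)) = _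
  rw [h]
  have h2 := Matrix.det_permute i.cycleRange.symm
    (Matrix.of fun j k => Function.update x i y j k)
  rw [Equiv.Perm.sign_symm, Fin.sign_cycleRange] at h2
  have h3 : detVec (Function.update x i y ∘ i.cycleRange.symm) =
      (-1) ^ (i : ℕ) * detVec (Function.update x i y) := by
    refine Eq.trans ?_ (h2.trans ?_)
    · rfl
    · simp [detVec]
  rw [h3, ← mul_assoc, ← mul_pow]
  simp

theorem inner_self_signedWedge (i : Fin (n + 1)) (x : Fin (n + 1) → E (n + 1)) :
    inner ℝ (x i) (signedWedge i x) = detVec x := by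
  rw [inner_signedWedge, Function.update_eq_self]

end Determinant

/-! ### Pointwise extremality as equality in the constraint -/

section Extremality

variable {n : ℕ} {φ : Fin (n + 1) → E (n + 1) → EReal}

theorem Extremal.exists_sum_eq_detVec (hbot : ∀ i x, φ i x ≠ ⊥) {i : Fin (n + 1)}
    {x : Fin (n + 1) → E (n + 1)} (h : Extremal φ i x) :
    (∀ j, φ j (x j) ≠ ⊤) ∧ ∑ j, (φ j (x j)).toReal = detVec x := by
  obtain ⟨h1, hti, hbi, h2⟩ := h
  have ha := (EReal.coe_toReal hti hbi).symm
  set a := (φ i (x i)).toReal with hadef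
  -- Fenchel equality: the subgradient inequality says that the supremum defining the conjugate is
  -- attained at `x i`.
  have hconj : conjugate (φ i) (signedWedge i x) = ((detVec x - a : ℝ) : EReal) := by
    apply le_antisymm
    · refine iSup_le fun y => ?_
      have h3 := h2 y
      rw [ha, inner_sub_left, inner_self_signedWedge] at h3
      generalize φ i y = b at h3
      induction b with
      | bot => exact absurd h3 (by
          rw [← EReal.coe_add, not_le]; exact EReal.bot_lt_coe _)
      | top => simp
      | coe b =>
        rw [← EReal.coe_add, EReal.coe_le_coe_iff] at h3
        rw [← EReal.coe_sub, EReal.coe_le_coe_iff]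
        linarith
    · have := le_iSup (fun y => ((inner ℝ y (signedWedge i x) : ℝ) : EReal) - φ i y) (x i)
      rwa [inner_self_signedWedge, ha, ← EReal.coe_sub] at this
  rw [hconj] at h1
  have hfin : ∀ j, φ j (x j) ≠ ⊤ := by
    intro j
    rcases eq_or_ne j i with rfl | hj
    · exact hti
    · exact ereal_ne_top_of_sum_ne_top (fun k _ => hbot k (x k))
        (by rw [h1]; exact EReal.coe_ne_top _) (Finset.mem_erase.2 ⟨hj, Finset.mem_univ j⟩)
  refine ⟨hfin, ?_⟩
  rw [Finset.sum_congr rfl fun j _ => (EReal.coe_toReal (hfin j) (hbot j (x j))).symm,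
    ← ereal_coe_sum, EReal.coe_eq_coe_iff] at h1
  rw [← Finset.add_sum_erase _ _ (Finset.mem_univ i), h1]
  linarith

theorem extremal_of_sum_eq_detVec (hφ : φ ∈ admissible (n + 1)) {x : Fin (n + 1) → E (n + 1)}
    (hfin : ∀ j, φ j (x j) ≠ ⊤) (hsum : ∑ j, (φ j (x j)).toReal = detVec x)
    (i : Fin (n + 1)) : Extremal φ i x := by
  obtain ⟨hbot, -, hdet⟩ := hφ
  have hcoe : ∀ j, φ j (x j) = ((φ j (x j)).toReal : EReal) := fun j =>
    (EReal.coe_toReal (hfin j) (hbot j (x j))).symm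
  set u : Fin (n + 1) → ℝ := fun j => (φ j (x j)).toReal with hu
  change ∑ j, u j = detVec x at hsum
  rw [← Finset.add_sum_erase _ _ (Finset.mem_univ i)] at hsum
  have herase : ∑ j ∈ Finset.univ.erase i, φ j (x j) =
      ((∑ j ∈ Finset.univ.erase i, u j : ℝ) : EReal) := by
    rw [ereal_coe_sum]
    exact Finset.sum_congr rfl fun j _ => hcoe j
  -- The constraint with the `i`-th vector replaced by `y`. By `hsum` it is an equality at `y = x
  -- i`, and both extremality conditions follow.
  have hupd : ∀ y, ((inner ℝ y (signedWedge i x) : ℝ) : EReal) ≤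
      φ i y + ((∑ j ∈ Finset.univ.erase i, u j : ℝ) : EReal) := by
    intro y
    rw [inner_signedWedge]
    refine (hdet _).trans_eq ?_
    rw [← Finset.add_sum_erase _ _ (Finset.mem_univ i), Function.update_self, ← herase]
    congr 1
    exact Finset.sum_congr rfl fun j hj => by
      rw [Function.update_of_ne (Finset.ne_of_mem_erase hj)]
  refine ⟨?_, hfin i, hbot i _, fun y => ?_⟩
  · rw [herase]
    apply le_antisymm
    · have := le_iSup (fun y => ((inner ℝ y (signedWedge i x) : ℝ) : EReal) - φ i y) (x i)
      rw [inner_self_signedWedge, hcoe i, ← EReal.coe_sub, ← hsum] at this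
      refine le_trans (EReal.coe_le_coe_iff.2 ?_) this
      simp [hu]
    · refine iSup_le fun y => ?_
      have h := hupd y
      have hb := hbot i y
      generalize φ i y = b at h hb
      induction b with
      | bot => exact absurd rfl hb
      | top => simp
      | coe b =>
        rw [← EReal.coe_add, EReal.coe_le_coe_iff] at h
        rw [← EReal.coe_sub, EReal.coe_le_coe_iff]
        linarith
  · have h := hupd y
    have hb := hbot i y
    rw [inner_sub_left, inner_self_signedWedge, hcoe i, ← EReal.coe_add]
    generalize φ i y = b at h hb
    induction b with
    | bot => exact absurd rfl hb
    | top => simp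
    | coe b =>
      rw [← EReal.coe_add, EReal.coe_le_coe_iff] at h
      rw [EReal.coe_le_coe_iff, ← hsum]
      linarith

end Extremality

/-! ### Integrable coercive bounds from the moment condition -/

section Moments

variable {n : ℕ} {μ : Fin (n + 1) → Measure (E (n + 1))}

/-- The functions `y ↦ C |y| ^ p_i / p_i` of the moment condition: a coercive separable bound of
the determinant. -/
theorem MomentCondition.exists_growth [∀ i, IsProbabilityMeasure (μ i)]
    (hμ : MomentCondition μ) :
    ∃ h : Fin (n + 1) → E (n + 1) → ℝ, (∀ i, Continuous (h i)) ∧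
      (∀ i, Integrable (h i) (μ i)) ∧ (∀ i y, 0 ≤ h i y) ∧
      (∀ i, Integrable (fun y => ‖y‖) (μ i)) ∧
      (∀ x : Fin (n + 1) → E (n + 1), |detVec x| ≤ ∑ i, h i (x i)) ∧
      ∀ M, IsCompact {x : Fin (n + 1) → E (n + 1) | ∑ i, h i (x i) ≤ M} := by
  obtain ⟨p, hp, hsum, hfin⟩ := hμ
  have hp0 : ∀ i, 0 < p i := fun i => zero_lt_one.trans (hp i)
  -- The number of terms in the Leibniz expansion of the determinant.
  set C : ℝ := ((n + 1).factorial : ℝ) with hC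
  have hC1 : 1 ≤ C := Nat.one_le_cast.2 (Nat.factorial_pos _)
  have hcont : ∀ i, Continuous fun y : E (n + 1) => ‖y‖ ^ p i / p i := fun i =>
    (continuous_norm.rpow_const fun _ => Or.inr (hp0 i).le).div_const _
  have hnn : ∀ i (y : E (n + 1)), 0 ≤ ‖y‖ ^ p i / p i := fun i y =>
    div_nonneg (Real.rpow_nonneg (norm_nonneg _) _) (hp0 i).le
  have hint : ∀ i, Integrable (fun y : E (n + 1) => ‖y‖ ^ p i / p i) (μ i) := by
    intro i
    refine ⟨(hcont i).aestronglyMeasurable, ?_⟩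
    rw [hasFiniteIntegral_iff_ofReal (ae_of_all _ (hnn i))]
    exact (ENNReal.sum_ne_top.1 hfin.ne i (Finset.mem_univ i)).lt_top
  have hnorm : ∀ i (y : E (n + 1)), ‖y‖ ≤ 1 + p i * (‖y‖ ^ p i / p i) := by
    intro i y
    rw [mul_div_cancel₀ _ (hp0 i).ne']
    rcases le_total ‖y‖ 1 with h | h
    · exact h.trans (le_add_of_nonneg_right (Real.rpow_nonneg (norm_nonneg _) _))
    · have := Real.rpow_le_rpow_of_exponent_le h (hp i).le
      rw [Real.rpow_one] at this
      linarith
  refine ⟨fun i y => C * (‖y‖ ^ p i / p i), fun i => (hcont i).const_mul _,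
    fun i => (hint i).const_mul _, fun i y => mul_nonneg (by linarith) (hnn i y), fun i => ?_,
    fun x => ?_, fun M => ?_⟩
  · refine ((integrable_const (1 : ℝ)).add ((hint i).const_mul (p i))).mono'
      continuous_norm.aestronglyMeasurable (ae_of_all _ fun y => ?_)
    simpa using hnorm i y
  · refine (abs_detVec_le x).trans ?_
    rw [← Finset.mul_sum]
    refine mul_le_mul_of_nonneg_left ?_ (by linarith)
    -- Weighted AM–GM with weights `1 / p i`, applied to `‖x i‖ ^ p i`, bounds the product of the
    -- norms.
    have h := Real.geom_mean_le_arith_mean_weighted Finset.univ (fun i => 1 / p i)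
      (fun i => ‖x i‖ ^ p i) (fun i _ => (one_div_pos.2 (hp0 i)).le) hsum
      (fun i _ => Real.rpow_nonneg (norm_nonneg _) _)
    have h1 : ∀ i, (‖x i‖ ^ p i) ^ (1 / p i) = ‖x i‖ := fun i => by
      rw [← Real.rpow_mul (norm_nonneg _), mul_one_div_cancel (hp0 i).ne', Real.rpow_one]
    simp only [h1] at h
    refine h.trans_eq (Finset.sum_congr rfl fun i _ => by ring)
  · refine Metric.isCompact_of_isClosed_isBounded
      (isClosed_le (continuous_finsetSum _ fun i _ =>
        ((hcont i).comp (continuous_apply i)).const_mul _) continuous_const) ?_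
    refine (Metric.isBounded_closedBall (x := (0 : Fin (n + 1) → E (n + 1)))
      (r := 1 + (∑ j, p j) * |M|)).subset fun x hx => ?_
    have hP : 0 ≤ ∑ j, p j := Finset.sum_nonneg fun j _ => (hp0 j).le
    rw [mem_closedBall_zero_iff, pi_norm_le_iff_of_nonneg (by positivity)]
    intro i
    refine (hnorm i (x i)).trans (add_le_add le_rfl ?_)
    refine mul_le_mul (Finset.single_le_sum (fun j _ => (hp0 j).le) (Finset.mem_univ i)) ?_
      (hnn i _) hP
    have h1 : C * (‖x i‖ ^ p i / p i) ≤ ∑ j, C * (‖x j‖ ^ p j / p j) :=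
      Finset.single_le_sum (f := fun j => C * (‖x j‖ ^ p j / p j))
        (fun j _ => mul_nonneg (by linarith) (hnn j _)) (Finset.mem_univ i)
    have h2 := le_mul_of_one_le_left (hnn i (x i)) hC1
    have h3 : ∑ j, C * (‖x j‖ ^ p j / p j) ≤ M := hx
    exact (h2.trans (h1.trans h3)).trans (le_abs_self M)

end Moments

/-! ### Integrability of potentials and weak duality -/

section WeakDuality

variable {d : ℕ} {μ : Fin d → Measure (E d)} {φ : Fin d → E d → EReal}

theorem dualValue_eq_sum_integral {u : Fin d → E d → ℝ}
    (hae : ∀ i, ∀ᵐ y ∂(μ i), φ i y = (u i y : EReal)) (hu : ∀ i, Integrable (u i) (μ i)) :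
    dualValue μ φ = ((∑ i, ∫ y, u i y ∂(μ i) : ℝ) : EReal) := by
  have hpos : posPart μ φ = ∑ i, ∫⁻ y, ENNReal.ofReal (u i y) ∂(μ i) :=
    Finset.sum_congr rfl fun i _ => lintegral_congr_ae ((hae i).mono fun y hy => by simp [hy])
  have hneg : negPart μ φ = ∑ i, ∫⁻ y, ENNReal.ofReal (-u i y) ∂(μ i) :=
    Finset.sum_congr rfl fun i _ => lintegral_congr_ae ((hae i).mono fun y hy => by
      simp only [hy, ← EReal.coe_neg, EReal.real_coe_toENNReal])
  have h1 : ∀ i ∈ Finset.univ, ∫⁻ y, ENNReal.ofReal (u i y) ∂(μ i) ≠ ⊤ := fun i _ =>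
    (hu i).lintegral_lt_top.ne
  have h2 : ∀ i ∈ Finset.univ, ∫⁻ y, ENNReal.ofReal (-u i y) ∂(μ i) ≠ ⊤ := fun i _ =>
    (hu i).neg.lintegral_lt_top.ne
  have hp : posPart μ φ ≠ ⊤ := by rw [hpos]; exact ENNReal.sum_ne_top.2 h1
  have hn : negPart μ φ ≠ ⊤ := by rw [hneg]; exact ENNReal.sum_ne_top.2 h2
  rw [dualValue, if_neg hp, ← EReal.coe_ennreal_toReal hp, ← EReal.coe_ennreal_toReal hn,
    ← EReal.coe_sub, hpos, hneg, ENNReal.toReal_sum h1, ENNReal.toReal_sum h2,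
    ← Finset.sum_sub_distrib]
  exact congrArg _ (Finset.sum_congr rfl fun i _ =>
    (integral_eq_lintegral_pos_part_sub_lintegral_neg_part (hu i)).symm)

theorem measurePreserving_eval_of_mem_couplings {γ : Measure (Fin d → E d)}
    (hγ : γ ∈ couplings μ) (i : Fin d) : MeasurePreserving (fun x => x i) γ (μ i) :=
  ⟨measurable_pi_apply i, hγ.2 i⟩

theorem integral_eval_of_mem_couplings {γ : Measure (Fin d → E d)} (hγ : γ ∈ couplings μ)
    {u : Fin d → E d → ℝ} (hu : ∀ i, Integrable (u i) (μ i)) :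
    Integrable (fun x => ∑ i, u i (x i)) γ ∧
      ∫ x, ∑ i, u i (x i) ∂γ = ∑ i, ∫ y, u i y ∂(μ i) := by
  have h : ∀ i ∈ Finset.univ, Integrable (fun x : Fin d → E d => u i (x i)) γ := fun i _ =>
    (measurePreserving_eval_of_mem_couplings hγ i).integrable_comp_of_integrable (hu i)
  refine ⟨integrable_finsetSum _ h, (integral_finsetSum _ h).trans ?_⟩
  refine Finset.sum_congr rfl fun i _ => ?_
  have hm := (measurePreserving_eval_of_mem_couplings hγ i)
  rw [← hm.map_eq, integral_map hm.measurable.aemeasurable]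
  rw [hm.map_eq]
  exact (hu i).aestronglyMeasurable

theorem pi_mem_couplings [∀ i, IsProbabilityMeasure (μ i)] : Measure.pi μ ∈ couplings μ := by
  refine ⟨inferInstance, fun i => ?_⟩
  have := Measure.pi_map_eval μ i
  simpa using! this

theorem measurable_toReal_of_mem_admissible (hφ : φ ∈ admissible d) (i : Fin d) :
    Measurable fun y => (φ i y).toReal :=
  (hφ.2.1 i).measurable.ereal_toReal

theorem ae_eval_of_mem_couplings {γ : Measure (Fin d → E d)} (hγ : γ ∈ couplings μ)
    {P : Fin d → E d → Prop} (h : ∀ i, ∀ᵐ y ∂(μ i), P i y) : ∀ᵐ x ∂γ, ∀ i, P i (x i) :=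
  ae_all_iff.2 fun i =>
    (measurePreserving_eval_of_mem_couplings hγ i).quasiMeasurePreserving.ae (h i)

theorem ae_eq_toReal_of_posPart_ne_top (hφ : φ ∈ admissible d) (hp : posPart μ φ ≠ ⊤)
    (i : Fin d) : ∀ᵐ y ∂(μ i), φ i y = ((φ i y).toReal : EReal) := by
  have h1 : ∫⁻ y, (φ i y).toENNReal ∂(μ i) ≠ ⊤ :=
    ENNReal.sum_ne_top.1 hp i (Finset.mem_univ i)
  filter_upwards [ae_lt_top (measurable_ereal_toENNReal.comp (hφ.2.1 i).measurable) h1]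
    with y hy
  refine (EReal.coe_toReal ?_ (hφ.1 i y)).symm
  exact EReal.toENNReal_ne_top_iff.1 hy.ne

theorem sum_toReal_ge (hφ : φ ∈ admissible d) {x : Fin d → E d}
    (h : ∀ i, φ i (x i) = ((φ i (x i)).toReal : EReal)) :
    detVec x ≤ ∑ i, (φ i (x i)).toReal := by
  have := hφ.2.2 x
  rwa [Finset.sum_congr rfl fun i _ => h i, ← ereal_coe_sum, EReal.coe_le_coe_iff] at this

/-- Admissible potentials with finite positive part are integrable. -/
theorem integrable_toReal_of_posPart_ne_top {γ : Measure (Fin d → E d)} (hγ : γ ∈ couplings μ)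
    (hdet : Integrable (detVec : (Fin d → E d) → ℝ) γ) (hφ : φ ∈ admissible d)
    (hp : posPart μ φ ≠ ⊤) (i : Fin d) : Integrable (fun y => (φ i y).toReal) (μ i) := by
  have hae := ae_eq_toReal_of_posPart_ne_top hφ hp
  have hmeas := measurable_toReal_of_mem_admissible hφ
  have hposint : ∀ j, Integrable (fun y => max (φ j y).toReal 0) (μ j) := by
    intro j
    refine ⟨((hmeas j).max measurable_const).aestronglyMeasurable, ?_⟩
    rw [hasFiniteIntegral_iff_ofReal (ae_of_all _ fun y => le_max_right (φ j y).toReal 0)]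
    refine lt_of_le_of_lt (lintegral_mono_ae ((hae j).mono fun y hy => ?_))
      (ENNReal.sum_ne_top.1 hp j (Finset.mem_univ j)).lt_top
    rw [hy, EReal.real_coe_toENNReal, EReal.toReal_coe]
    exact ENNReal.ofReal_le_ofReal_iff'.2 (by
      rcases le_total (φ j y).toReal 0 with h | h
      · right; simp [h]
      · left; simp [h])
  have hS := (integral_eval_of_mem_couplings hγ hposint).1
  -- The constraint controls negative parts: `-φ i (x i) ≤ |detVec x| + ∑_{j ≠ i} φ j (x j)⁺`.
  -- Integrability holds under `γ` and then passes to the marginal.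
  have hcomp : Integrable (fun x : Fin d → E d => (φ i (x i)).toReal) γ := by
    refine (hdet.abs.add (hS.add hS)).mono'
      ((hmeas i).comp (measurable_pi_apply i)).aestronglyMeasurable ?_
    filter_upwards [ae_eval_of_mem_couplings hγ hae] with x hx
    have h1 := sum_toReal_ge hφ hx
    have h2 : ∑ j ∈ Finset.univ.erase i, (φ j (x j)).toReal ≤
        ∑ j ∈ Finset.univ.erase i, max (φ j (x j)).toReal 0 :=
      Finset.sum_le_sum fun j _ => le_max_left _ _
    have h3 : 0 ≤ ∑ j ∈ Finset.univ.erase i, max (φ j (x j)).toReal 0 :=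
      Finset.sum_nonneg fun j _ => le_max_right _ _
    rw [← Finset.add_sum_erase _ _ (Finset.mem_univ i)] at h1
    simp only [Pi.add_apply]
    rw [← Finset.add_sum_erase _ (fun j => max (φ j (x j)).toReal 0) (Finset.mem_univ i),
      Real.norm_eq_abs, abs_le]
    have h4 := neg_abs_le (detVec x)
    have h5 := abs_nonneg (detVec x)
    have h6 := le_max_left (φ i (x i)).toReal 0
    have h7 := le_max_right (φ i (x i)).toReal 0
    constructor <;> linarith
  have hm := measurePreserving_eval_of_mem_couplings hγ i
  rw [← hm.map_eq]
  exact (integrable_map_measure (hmeas i).aestronglyMeasurable hm.measurable.aemeasurable).2 hcomp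

theorem integral_detVec_le_dualValue {γ : Measure (Fin d → E d)} (hγ : γ ∈ couplings μ)
    (hdet : Integrable (detVec : (Fin d → E d) → ℝ) γ) (hφ : φ ∈ admissible d) :
    ((∫ x, detVec x ∂γ : ℝ) : EReal) ≤ dualValue μ φ := by
  by_cases hp : posPart μ φ = ⊤
  · simp [dualValue, hp]
  have hae := ae_eq_toReal_of_posPart_ne_top hφ hp
  have hint := integrable_toReal_of_posPart_ne_top hγ hdet hφ hp
  have hS := integral_eval_of_mem_couplings hγ hint
  rw [dualValue_eq_sum_integral hae hint, EReal.coe_le_coe_iff, ← hS.2]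
  refine integral_mono_ae hdet hS.1 ?_
  filter_upwards [ae_eval_of_mem_couplings hγ hae] with x hx
  exact sum_toReal_ge hφ hx

end WeakDuality

end DetTransport

namespace DetTransport

/-! ### Optimality and the contact set -/

section Optimality

variable {n : ℕ} {μ : Fin (n + 1) → Measure (E (n + 1))} {φ : Fin (n + 1) → E (n + 1) → EReal}

theorem integrable_detVec {γ : Measure (Fin (n + 1) → E (n + 1))} (hγ : γ ∈ couplings μ)
    {h : Fin (n + 1) → E (n + 1) → ℝ} (hint : ∀ i, Integrable (h i) (μ i))
    (hle : ∀ x : Fin (n + 1) → E (n + 1), |detVec x| ≤ ∑ i, h i (x i)) :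
    Integrable (detVec : (Fin (n + 1) → E (n + 1)) → ℝ) γ :=
  (integral_eval_of_mem_couplings hγ hint).1.mono' continuous_detVec.aestronglyMeasurable
    (ae_of_all _ hle)

/-- A component of an admissible tuple is bounded below by a function of linear growth, as soon
as there is a point where all the components are finite. -/
theorem exists_linear_lower_bound (hφ : φ ∈ admissible (n + 1)) {z : Fin (n + 1) → E (n + 1)}
    (hz : ∀ j, φ j (z j) ≠ ⊤) (j : Fin (n + 1)) :
    ∃ K K' : ℝ, 0 ≤ K ∧ 0 ≤ K' ∧ ∀ y, φ j y ≠ ⊤ → -(K * ‖y‖ + K') ≤ (φ j y).toReal := by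
  refine ⟨(n + 1).factorial * ∏ k ∈ Finset.univ.erase j, ‖z k‖,
    |∑ k ∈ Finset.univ.erase j, (φ k (z k)).toReal|, by positivity, abs_nonneg _, fun y hy => ?_⟩
  -- Freezing all vectors but the `j`-th at `z` makes the determinant linear in `y`.
  have h1 := sum_toReal_ge hφ (x := Function.update z j y) (fun k => by
    refine (EReal.coe_toReal ?_ (hφ.1 _ _)).symm
    rcases eq_or_ne k j with rfl | hk
    · simpa using hy
    · simpa [hk] using hz k)
  have h2 := neg_le_of_abs_le (abs_detVec_le (Function.update z j y))
  rw [← Finset.add_sum_erase _ _ (Finset.mem_univ j), Function.update_self,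
    Finset.sum_congr rfl fun k hk => by rw [Function.update_of_ne (Finset.ne_of_mem_erase hk)]]
    at h1
  rw [← Finset.mul_prod_erase _ _ (Finset.mem_univ j), Function.update_self,
    Finset.prod_congr rfl fun k hk => by rw [Function.update_of_ne (Finset.ne_of_mem_erase hk)]]
    at h2
  have h3 := le_abs_self (∑ k ∈ Finset.univ.erase j, (φ k (z k)).toReal)
  linarith

/-- Finiteness of `posPart` is not assumed. On the contact set `φ j (x j)` is `detVec x` minus the
other terms, so the linear lower bounds of those terms and the first moments bound it from above. -/
theorem dualValue_eq_integral_detVec [∀ i, IsProbabilityMeasure (μ i)]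
    {γ : Measure (Fin (n + 1) → E (n + 1))} (hγ : γ ∈ couplings μ)
    (hdet : Integrable (detVec : (Fin (n + 1) → E (n + 1)) → ℝ) γ)
    (hnorm : ∀ i, Integrable (fun y => ‖y‖) (μ i)) (hφ : φ ∈ admissible (n + 1))
    (hae : ∀ᵐ x ∂γ, (∀ j, φ j (x j) ≠ ⊤) ∧ ∑ j, (φ j (x j)).toReal = detVec x) :
    dualValue μ φ = ((∫ x, detVec x ∂γ : ℝ) : EReal) := by
  have := hγ.1
  have hmeas := measurable_toReal_of_mem_admissible hφ
  obtain ⟨z, hz, -⟩ := hae.exists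
  choose K K' hK hK' hlow using exists_linear_lower_bound hφ hz
  have hb : ∀ j, Integrable (fun y => K j * ‖y‖ + K' j) (μ j) := fun j =>
    ((hnorm j).const_mul _).add (integrable_const _)
  have hb0 : ∀ j (y : E (n + 1)), 0 ≤ K j * ‖y‖ + K' j := fun j y =>
    add_nonneg (mul_nonneg (hK j) (norm_nonneg _)) (hK' j)
  have hB := (integral_eval_of_mem_couplings hγ hb).1
  have hint : ∀ j, Integrable (fun y => (φ j y).toReal) (μ j) := by
    intro j
    have hcomp : Integrable (fun x : Fin (n + 1) → E (n + 1) => (φ j (x j)).toReal) γ := by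
      refine (hdet.abs.add hB).mono'
        ((hmeas j).comp (measurable_pi_apply j)).aestronglyMeasurable ?_
      filter_upwards [hae] with x hx
      have h1 : -∑ k ∈ Finset.univ.erase j, (K k * ‖x k‖ + K' k) ≤
          ∑ k ∈ Finset.univ.erase j, (φ k (x k)).toReal := by
        rw [← Finset.sum_neg_distrib]
        exact Finset.sum_le_sum fun k _ => hlow k _ (hx.1 k)
      have h2 := hx.2
      have h3 : 0 ≤ ∑ k ∈ Finset.univ.erase j, (K k * ‖x k‖ + K' k) :=
        Finset.sum_nonneg fun k _ => hb0 k _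
      have h4 := hlow j _ (hx.1 j)
      have h5 := hb0 j (x j)
      have h6 := le_abs_self (detVec x)
      have h7 := abs_nonneg (detVec x)
      rw [← Finset.add_sum_erase _ _ (Finset.mem_univ j)] at h2
      simp only [Pi.add_apply]
      rw [← Finset.add_sum_erase _ _ (Finset.mem_univ j), Real.norm_eq_abs, abs_le]
      constructor <;> linarith
    have hm := measurePreserving_eval_of_mem_couplings hγ j
    rw [← hm.map_eq]
    exact (integrable_map_measure (hmeas j).aestronglyMeasurable
      hm.measurable.aemeasurable).2 hcomp
  have hfin : ∀ j, ∀ᵐ y ∂(μ j), φ j y = ((φ j y).toReal : EReal) := by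
    intro j
    have hm := measurePreserving_eval_of_mem_couplings hγ j
    rw [← hm.map_eq, ae_map_iff hm.measurable.aemeasurable
      (measurableSet_eq_fun (hφ.2.1 j).measurable (hmeas j).coe_real_ereal)]
    exact hae.mono fun x hx => (EReal.coe_toReal (hx.1 j) (hφ.1 _ _)).symm
  rw [dualValue_eq_sum_integral hfin hint, ← (integral_eval_of_mem_couplings hγ hint).2]
  exact congrArg _ (integral_congr_ae (hae.mono fun x hx => hx.2))

theorem solvesDual_of_ae_extremal [∀ i, IsProbabilityMeasure (μ i)] (hμ : MomentCondition μ)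
    (hφ : φ ∈ admissible (n + 1)) {γ : Measure (Fin (n + 1) → E (n + 1))}
    (hγ : γ ∈ couplings μ) {i : Fin (n + 1)} (h : ∀ᵐ x ∂γ, Extremal φ i x) :
    SolvesDual μ φ := by
  obtain ⟨g, -, hint, -, hnorm, hle, -⟩ := hμ.exists_growth
  have hdet := integrable_detVec hγ hint hle
  refine ⟨hφ, fun ψ hψ => ?_⟩
  rw [dualValue_eq_integral_detVec hγ hdet hnorm hφ
    (h.mono fun x hx => hx.exists_sum_eq_detVec hφ.1)]
  exact integral_detVec_le_dualValue hγ hdet hψ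

theorem mem_admissible_of_continuous {ψ : Fin (n + 1) → E (n + 1) → ℝ}
    (hc : ∀ i, Continuous (ψ i)) (h : ∀ x : Fin (n + 1) → E (n + 1),
      detVec x ≤ ∑ i, ψ i (x i)) :
    (fun i y => (ψ i y : EReal)) ∈ admissible (n + 1) :=
  ⟨fun _ _ => EReal.coe_ne_bot _,
    fun i => (continuous_coe_real_ereal.comp (hc i)).lowerSemicontinuous,
    fun x => by rw [← ereal_coe_sum]; exact EReal.coe_le_coe_iff.2 (h x)⟩

theorem SolvesDual.exists_ae_extremal [∀ i, IsProbabilityMeasure (μ i)]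
    (hμ : MomentCondition μ) (h : SolvesDual μ φ) :
    ∃ γ ∈ couplings μ, ∀ i, ∀ᵐ x ∂γ, Extremal φ i x := by
  obtain ⟨hφ, hmin⟩ := h
  obtain ⟨g, hgc, hgint, hg0, -, hle, hK⟩ := hμ.exists_growth
  -- The product measure is a coupling available from the start; it gives integrability of the
  -- potentials and a first weak duality bound.
  have hπ := pi_mem_couplings (μ := μ)
  have hdetπ := integrable_detVec hπ hgint hle
  have hmin' : ∀ ψ : Fin (n + 1) → E (n + 1) → ℝ, (∀ i, Continuous (ψ i)) →
      (∀ i, Integrable (ψ i) (μ i)) → (∀ x : Fin (n + 1) → E (n + 1),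
        detVec x ≤ ∑ i, ψ i (x i)) →
      dualValue μ φ ≤ ((∑ i, ∫ y, ψ i y ∂(μ i) : ℝ) : EReal) := by
    intro ψ hc hi hx
    have := hmin _ (mem_admissible_of_continuous hc hx)
    rwa [dualValue_eq_sum_integral (fun i => ae_of_all _ fun y => rfl) hi] at this
  have hp : posPart μ φ ≠ ⊤ := by
    intro hp
    have := hmin' g hgc hgint fun x => (le_abs_self _).trans (hle x)
    rw [dualValue, if_pos hp, top_le_iff] at this
    exact EReal.coe_ne_top _ this
  have hae := ae_eq_toReal_of_posPart_ne_top hφ hp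
  have hint := integrable_toReal_of_posPart_ne_top hπ hdetπ hφ hp
  have hval := dualValue_eq_sum_integral hae hint
  have hweak := integral_detVec_le_dualValue hπ hdetπ hφ
  rw [hval] at hmin' hweak
  simp only [EReal.coe_le_coe_iff] at hmin' hweak
  set D := ∑ i, ∫ y, (φ i y).toReal ∂(μ i) with hDdef
  obtain ⟨γ, hprob, hmarg, hD⟩ := exists_coupling_le_integral μ detVec continuous_detVec g hgc
    hgint hg0 hle hK D (by
      intro ψ hc hi t ht
      -- For `t ≤ 0`, integrate against the product measure and use `hweak`; for `t > 0`, `t⁻¹ ψ` is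
      -- a competitor in (D), so minimality applies.
      rcases le_or_gt t 0 with h0 | h0
      · have hS := integral_eval_of_mem_couplings hπ hi
        have h1 := integral_mono (hdetπ.const_mul t) hS.1 ht
        rw [integral_const_mul, hS.2] at h1
        exact (mul_le_mul_of_nonpos_left hweak h0).trans h1
      · have h1 := hmin' (fun i y => t⁻¹ * ψ i y) (fun i => (hc i).const_mul _)
          (fun i => (hi i).const_mul _) (fun x => by
            rw [← Finset.mul_sum, ← div_eq_inv_mul, le_div_iff₀ h0, mul_comm]
            exact ht x)
        simp only [integral_const_mul, ← Finset.mul_sum] at h1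
        rwa [← div_eq_inv_mul, le_div_iff₀ h0, mul_comm] at h1)
  have hγ : γ ∈ couplings μ := ⟨hprob, hmarg⟩
  have hdet := integrable_detVec hγ hgint hle
  have hS := integral_eval_of_mem_couplings hγ hint
  have haeγ := ae_eval_of_mem_couplings hγ hae
  have hgap : 0 ≤ᵐ[γ] fun x => ∑ i, (φ i (x i)).toReal - detVec x :=
    haeγ.mono fun x hx => sub_nonneg.2 (sum_toReal_ge hφ hx)
  have hzero : ∫ x, (∑ i, (φ i (x i)).toReal - detVec x) ∂γ = 0 := by
    refine le_antisymm ?_ (integral_nonneg_of_ae hgap)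
    rw [integral_sub hS.1 hdet, hS.2]
    linarith
  rw [integral_eq_zero_iff_of_nonneg_ae hgap (hS.1.sub hdet)] at hzero
  refine ⟨γ, hγ, fun i => ?_⟩
  filter_upwards [hzero, haeγ] with x hx hfin
  exact extremal_of_sum_eq_detVec hφ (fun j => by rw [hfin j]; exact EReal.coe_ne_top _)
    (sub_eq_zero.1 hx) i

end Optimality

end DetTransport

theorem mainTheorem5 {n : ℕ}
    (μ : Fin (n + 1) → MeasureTheory.Measure (DetTransport.E (n + 1)))
    [∀ i, MeasureTheory.IsProbabilityMeasure (μ i)]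
    (hμ : DetTransport.MomentCondition μ)
    (φ : Fin (n + 1) → DetTransport.E (n + 1) → EReal)
    (hφ : φ ∈ DetTransport.convexAdmissible (n + 1)) :
    List.TFAE [
      DetTransport.SolvesDual μ φ,
      ∃ γ ∈ DetTransport.couplings μ, ∀ i : Fin (n + 1), ∀ᵐ x ∂γ, DetTransport.Extremal φ i x,
      ∃ γ ∈ DetTransport.couplings μ, ∃ i : Fin (n + 1), ∀ᵐ x ∂γ, DetTransport.Extremal φ i x] := by
  tfae_have 1 → 2 := fun h => h.exists_ae_extremal hμ
  tfae_have 2 → 3 := fun ⟨γ, hγ, h⟩ => ⟨γ, hγ, 0, h 0⟩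
  tfae_have 3 → 1 := fun ⟨_, hγ, _, h⟩ => DetTransport.solvesDual_of_ae_extremal hμ hφ.1 hγ h
  tfae_finish
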